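/- Let $(W,S)$ be a Coxeter system with Coxeter matrix $(m_{s,t})_{s,t\in S}$ ($S$ and $W$ possibly infinite), let $k$ be a commutative ring and let $A$ be a commutative $k$-algebra that is free as a $k$-module. Let $\rho\colon W\to\mathrm{Aut}_{k\text{-alg}}(A)$ be an action of $W$ on $A$ by $k$-algebra automorphisms, written $w.c=\rho_w(c)$, and let $a\colon S\to A^\times$, $s\mapsto a_s$, be a $W$-equivariant map, i.e. $w.a_s=a_t$ whenever $s,t\in S$ and $w\in W$ satisfy $wsw^{-1}=t$. Let $B_W$ be the Artin braid group of $(W,S)$, i.e. the group with generators $g_s$, $s\in S$, and the braid relations $g_sg_tg_s\cdots=g_tg_sg_t\cdots$ ($m_{s,t}$ factors on each side) for all $s\neq t$ with $m_{s,t}<\infty$; let $\pi\colon B_W\to W$, $g_s\mapsto s$, be the projection, and for $w\in W$ let $g_w=g_{s_1}\cdots g_{s_r}\in B_W$, where $w=s_1\cdots s_r$ is a reduced expression (by Matsumoto's theorem $g_w$ does not depend on it). Let $A\rtimes k[B_W]$ be the skew group ring of finite sums $\sum_{b\in B_W}c_b\,b$ with $c_b\in A$ and multiplication determined by $b\,c=(\pi(b).c)\,b$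 for $b\in B_W$, $c\in A$. The Marin ring $\mathcal{E}^{(W,S)}(A,\rho,a)$ is the quotient of $A\rtimes k[B_W]$ by the two-sided ideal generated by the elements $$g_s^2-a_s-(1-a_s)g_s,\qquad s\in S;$$ it is a left $A$-module by left multiplication, and the image of $g_w$ in it is again denoted by $g_w$. Then $\mathcal{E}^{(W,S)}(A,\rho,a)$ is a free left $A$-module with basis $\{g_w\}_{w\in W}$ if and only if, for every $s\in S$, $$(1-a_s)(1-\rho_s)=0\quad\text{in }\mathrm{End}_k(A),$$ where $a_s$ stands for the operator of multiplication by $a_s$ on $A$. -/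

import Mathlib

namespace CoxeterSystem

variable {B W : Type*} [Group W] {M : CoxeterMatrix B}

/-- The braid relators `(⋯ sᵢ sⱼ)(⋯ sⱼ sᵢ)⁻¹` (each factor an alternating word of length `mᵢⱼ`).
For `i = j` the relator is trivial, and so it is for `mᵢⱼ = ∞`, which Mathlib encodes
as `M i j = 0`. -/
def braidRelators (_cs : CoxeterSystem M W) : Set (FreeGroup B) :=
  Set.range fun p : B × B =>
    ((braidWord M p.1 p.2).map FreeGroup.of).prod *
      ((braidWord M p.2 p.1).map FreeGroup.of).prod⁻¹

/-- The Artin braid group `B_W` of the Coxeter system. -/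
def ArtinGroup (cs : CoxeterSystem M W) : Type _ := PresentedGroup cs.braidRelators

instance (cs : CoxeterSystem M W) : Group cs.ArtinGroup :=
  inferInstanceAs (Group (PresentedGroup cs.braidRelators))

/-- The standard generators of the Artin braid group. -/
def artinGen (cs : CoxeterSystem M W) (i : B) : cs.ArtinGroup :=
  PresentedGroup.of (rels := cs.braidRelators) i

theorem lift_braidRelators (cs : CoxeterSystem M W) :
    ∀ r ∈ cs.braidRelators, FreeGroup.lift cs.simple r = 1 := by
  rintro _ ⟨⟨i, j⟩, rfl⟩
  have h : ∀ ω : List B, FreeGroup.lift cs.simple (ω.map FreeGroup.of).prod = cs.wordProd ω := by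
    intro ω
    simp [wordProd, map_list_prod, Function.comp_def]
  simp only [map_mul, map_inv, h]
  rw [cs.wordProd_braidWord_eq i j, mul_inv_cancel]

/-- The projection `π : B_W → W`. -/
def artinProj (cs : CoxeterSystem M W) : cs.ArtinGroup →* W :=
  PresentedGroup.toGroup cs.lift_braidRelators

@[simp]
theorem artinProj_artinGen (cs : CoxeterSystem M W) (i : B) :
    cs.artinProj (cs.artinGen i) = cs.simple i :=
  PresentedGroup.toGroup.of cs.lift_braidRelators

/-- The canonical set-theoretical section `w ↦ g_w` of `π`: the product of the generators of
the Artin group along a reduced word of `w` (by Matsumoto's theorem, the choice of the reduced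
word is immaterial). -/
noncomputable def artinSection (cs : CoxeterSystem M W) (w : W) : cs.ArtinGroup :=
  ((cs.exists_isReduced w).choose.map cs.artinGen).prod

theorem artinProj_artinSection (cs : CoxeterSystem M W) (w : W) :
    cs.artinProj (cs.artinSection w) = w := by
  have h := (cs.exists_isReduced w).choose_spec.2
  conv_rhs => rw [h]
  simp [artinSection, wordProd, map_list_prod, Function.comp_def]

variable {A : Type*} [CommRing A] [MulSemiringAction W A]

/-- The Artin braid group acts on `A` through `π : B_W → W`. -/
instance (cs : CoxeterSystem M W) : MulSemiringAction cs.ArtinGroup A :=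
  MulSemiringAction.compHom A cs.artinProj

theorem artinGroup_smul_def (cs : CoxeterSystem M W) (b : cs.ArtinGroup) (c : A) :
    b • c = cs.artinProj b • c := rfl

/-- `W`-equivariance of `a : S → Aˣ` with respect to the (partially defined) conjugation action
on `S`: whenever `w s w⁻¹ = t` with `s, t ∈ S`, one has `w • a_s = a_t`. -/
def IsEquivariant (cs : CoxeterSystem M W) (a : B → Aˣ) : Prop :=
  ∀ (i j : B) (w : W), w * cs.simple i * w⁻¹ = cs.simple j → w • (a i : A) = (a j : A)

/-- The semidirect product `A ⋊ k[B_W]`, i.e. the skew group ring whose elements are finite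
sums `∑ c_b b` with `c_b ∈ A`, `b ∈ B_W`, and whose product obeys `b c = (π(b) • c) b`. -/
abbrev CrossedProduct (cs : CoxeterSystem M W) (A : Type*) [CommRing A]
    [MulSemiringAction W A] : Type _ :=
  SkewMonoidAlgebra A cs.ArtinGroup

/-- The elements `g_s² - a_s - (1 - a_s) g_s`. -/
noncomputable def heckeRelator (cs : CoxeterSystem M W) (a : B → Aˣ) (i : B) :
    cs.CrossedProduct A :=
  (SkewMonoidAlgebra.single (cs.artinGen i) 1) ^ 2
    - SkewMonoidAlgebra.single 1 (a i : A)
    - SkewMonoidAlgebra.single 1 (1 - (a i : A)) * SkewMonoidAlgebra.single (cs.artinGen i) 1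

/-- The two-sided ideal generated by the elements `g_s² - a_s - (1 - a_s) g_s`, `s ∈ S`. -/
noncomputable def heckeIdeal (cs : CoxeterSystem M W) (a : B → Aˣ) :
    TwoSidedIdeal (cs.CrossedProduct A) :=
  TwoSidedIdeal.span (Set.range (cs.heckeRelator a))

/-- The Marin ring: the quotient of `A ⋊ k[B_W]` by the two-sided ideal generated by the
elements `g_s² - a_s - (1 - a_s) g_s`. Its left `A`-module structure is induced by left
multiplication by `A` on `A ⋊ k[B_W]`. -/
abbrev MarinRing (cs : CoxeterSystem M W) (a : B → Aˣ) : Type _ :=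
  cs.CrossedProduct A ⧸ (cs.heckeIdeal a).asIdeal

/-- The element `g_w` of the Marin ring. -/
noncomputable def marinG (cs : CoxeterSystem M W) (a : B → Aˣ) (w : W) : cs.MarinRing a :=
  Ideal.Quotient.mk (cs.heckeIdeal a).asIdeal (SkewMonoidAlgebra.single (cs.artinSection w) 1)

end CoxeterSystem

/-! Necessity: `g_s ^ 2` projects to `1` in `W`, so it commutes with every `c` in `A`. Expanding it
by the quadratic relation gives `(1 - a_s)(s.c) g_s = (1 - a_s) c g_s`, and freeness lets one
compare coefficients at `g_s`.

Spanning holds without the condition: the `A`-span of the `g_w` contains `1` and is stable under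
right multiplication by `A`, by the generators and, since each `a_s` is a unit, by their inverses.

Independence follows by letting the Marin ring act on the free module with basis `e_w` so that `g_w
e_1 = e_w`. Left multiplication by `g_s` is written down as a semilinear operator `leftOp`; the
condition gives its quadratic relation (`leftOp_leftOp`). For the braid relations, right
multiplications `rightOp` are introduced and shown to commute with the left ones (`leftOp_rightOp`).
Left operators along two reduced words of one element agree on `e_1`, hence on all `e_w`, which
right operators reach from `e_1` (`prod_leftOp_eq_of_isReduced`).

The Coxeter combinatorics behind this is the exchange condition, the exact order of `s_i s_j` (from
the geometric representation), and Matsumoto's theorem. -/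

namespace Module

/-! ### Products of two reflections. -/

variable {V : Type*} [AddCommGroup V] [Module ℝ V] {x y : V} {f g : Dual ℝ V} {θ : ℝ}

/-- On the span of `x` and `y` the product acts as a rotation by `2θ`. Multiplying by `sin θ` clears
the denominators, so `sin θ = 0` need not be excluded. -/
theorem sin_smul_reflection_mul_reflection_pow_left (hf : f x = 2) (hg : g y = 2)
    (hfy : f y = -2 * Real.cos θ) (hgx : g x = -2 * Real.cos θ) (n : ℕ) :
    Real.sin θ • ((reflection hf * reflection hg) ^ n) x =
      Real.sin ((2 * n + 1) * θ) • x + Real.sin (2 * n * θ) • y := by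
  induction n with
  | zero => simp
  | succ n ih =>
    rw [pow_succ', LinearEquiv.mul_apply, ← map_smul, ih]
    -- Every angle becomes `2nθ` plus copies of `θ`; the addition formulas then leave a polynomial
    -- identity modulo `sin² + cos² = 1`.
    have h₁ : (2 * ((n + 1 : ℕ) : ℝ) + 1) * θ = 2 * n * θ + θ + θ + θ := by push_cast; ring
    have h₂ : 2 * ((n + 1 : ℕ) : ℝ) * θ = 2 * n * θ + θ + θ := by push_cast; ring
    have h₃ : (2 * (n : ℝ) + 1) * θ = 2 * n * θ + θ := by ring
    have h₄ := Real.sin_sq_add_cos_sq θ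
    rw [h₁, h₂, h₃]
    simp only [LinearEquiv.mul_apply, reflection_apply, map_add, map_sub, map_smul, hf, hg, hfy,
      hgx, Real.sin_add, Real.cos_add]
    match_scalars
    · linear_combination (3 * Real.sin (2 * n * θ) * Real.cos θ
        + Real.sin θ * Real.cos (2 * n * θ)) * h₄
    · linear_combination (Real.sin (2 * n * θ)) * h₄

theorem sin_smul_reflection_mul_reflection_pow_right (hf : f x = 2) (hg : g y = 2)
    (hfy : f y = -2 * Real.cos θ) (hgx : g x = -2 * Real.cos θ) (n : ℕ) :
    Real.sin θ • ((reflection hf * reflection hg) ^ n) y =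
      -Real.sin (2 * n * θ) • x - Real.sin ((2 * n - 1) * θ) • y := by
  induction n with
  | zero => simp
  | succ n ih =>
    rw [pow_succ', LinearEquiv.mul_apply, ← map_smul, ih]
    have h₁ : (2 * ((n + 1 : ℕ) : ℝ) - 1) * θ = 2 * n * θ + θ := by push_cast; ring
    have h₂ : 2 * ((n + 1 : ℕ) : ℝ) * θ = 2 * n * θ + θ + θ := by push_cast; ring
    have h₃ : (2 * (n : ℝ) - 1) * θ = 2 * n * θ - θ := by ring
    have h₄ := Real.sin_sq_add_cos_sq θ
    rw [h₁, h₂, h₃]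
    simp only [LinearEquiv.mul_apply, reflection_apply, map_sub, map_smul, hf, hg, hfy,
      hgx, Real.sin_add, Real.sin_sub, Real.cos_add]
    match_scalars
    · linear_combination (-Real.sin (2 * n * θ)) * h₄
    · ring

/-- The `m`-th power is a rotation by `2π` on the span of `x, y` and the identity on `ker f ∩ ker
g`; these span `V` because the determinant `4 sin² θ` of the pairing is nonzero. -/
theorem reflection_mul_reflection_pow_eq_one (hf : f x = 2) (hg : g y = 2)
    (hfy : f y = -2 * Real.cos θ) (hgx : g x = -2 * Real.cos θ) (hθ : Real.sin θ ≠ 0)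
    {m : ℕ} (hm : m * θ = Real.pi) : (reflection hf * reflection hg) ^ m = 1 := by
  have h2m : 2 * (m : ℝ) * θ = 2 * Real.pi := by linear_combination 2 * hm
  have hx : ((reflection hf * reflection hg) ^ m) x = x := by
    apply smul_right_injective V hθ
    have h : (2 * (m : ℝ) + 1) * θ = θ + 2 * Real.pi := by linear_combination 2 * hm
    simp only [sin_smul_reflection_mul_reflection_pow_left hf hg hfy hgx, h, h2m]
    simp
  have hy : ((reflection hf * reflection hg) ^ m) y = y := by
    apply smul_right_injective V hθ
    have h : (2 * (m : ℝ) - 1) * θ = -θ + 2 * Real.pi := by linear_combination 2 * hm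
    simp only [sin_smul_reflection_mul_reflection_pow_right hf hg hfy hgx, h, h2m]
    simp [Real.sin_add]
  have hz : ∀ z, f z = 0 → g z = 0 → ((reflection hf * reflection hg) ^ m) z = z := by
    intro z hfz hgz
    clear hm h2m hx hy
    induction m with
    | zero => simp
    | succ n ih =>
      rw [pow_succ', LinearEquiv.mul_apply, ih]
      simp [reflection_apply, hfz, hgz]
  ext z
  -- `α` and `β` solve the linear system saying that `z - α x - β y` is killed by `f` and `g`.
  set α := (f z + Real.cos θ * g z) / (2 * Real.sin θ ^ 2) with hα
  set β := (g z + Real.cos θ * f z) / (2 * Real.sin θ ^ 2) with hβ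
  have hs := Real.sin_sq_add_cos_sq θ
  have key := hz (z - α • x - β • y)
    (by
      simp only [map_sub, map_smul, hf, hfy, smul_eq_mul, hα, hβ]
      field_simp
      linear_combination (f z) * hs)
    (by
      simp only [map_sub, map_smul, hg, hgx, smul_eq_mul, hα, hβ]
      field_simp
      linear_combination (g z) * hs)
  simp only [map_sub, map_smul, hx, hy] at key
  simpa using key

/-- The degenerate case `θ = 0`: both reflections fix `x + y`, and coefficients grow linearly, which
will force infinite order. -/
theorem reflection_mul_reflection_pow_left_of_parallel (hf : f x = 2) (hg : g y = 2)
    (hfy : f y = -2) (hgx : g x = -2) (n : ℕ) :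
    ((reflection hf * reflection hg) ^ n) x = (2 * n + 1 : ℝ) • x + (2 * n : ℝ) • y := by
  induction n with
  | zero => simp
  | succ n ih =>
    rw [pow_succ', LinearEquiv.mul_apply, ih]
    simp only [LinearEquiv.mul_apply, reflection_apply, map_add, map_sub, map_smul, hf, hg, hfy,
      hgx]
    rw [Nat.cast_succ]
    module

end Module

/-! ### The geometric representation and the order of `s_i s_j`. -/

namespace CoxeterSystem

variable {B W : Type*} [Group W] {M : CoxeterMatrix B}

/-- The coroots of the geometric representation of a Coxeter system on `B →₀ ℝ`. -/
noncomputable def geomCoroot (M : CoxeterMatrix B) (i : B) : Module.Dual ℝ (B →₀ ℝ) :=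
  Finsupp.linearCombination ℝ fun j => -2 * Real.cos (Real.pi / M i j)

/-- When `M i j = 0`, encoding `∞`, division by zero gives `cos 0 = 1` and the pairing is `-2`, as
it should be. -/
theorem geomCoroot_single (i j : B) :
    geomCoroot M i (Finsupp.single j 1) = -2 * Real.cos (Real.pi / M i j) := by
  simp [geomCoroot]

theorem geomCoroot_single_self (i : B) : geomCoroot M i (Finsupp.single i 1) = 2 := by
  simp [geomCoroot_single]

/-- The generators of the geometric representation of a Coxeter system. -/
noncomputable def geomReflection (M : CoxeterMatrix B) (i : B) : (B →₀ ℝ) ≃ₗ[ℝ] (B →₀ ℝ) :=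
  Module.reflection (geomCoroot_single_self (M := M) i)

theorem sin_pi_div_pos {m : ℕ} (hm : 2 ≤ m) : 0 < Real.sin (Real.pi / m) := by
  have h : (2 : ℝ) ≤ m := by exact_mod_cast hm
  apply Real.sin_pos_of_pos_of_lt_pi
  · exact div_pos Real.pi_pos (by linarith)
  · exact div_lt_self Real.pi_pos (by linarith)

theorem isLiftable_geomReflection : M.IsLiftable (geomReflection M) := by
  intro i j
  rcases eq_or_ne i j with rfl | hij
  · rw [M.diagonal, pow_one]
    exact mul_eq_one_iff_eq_inv.2 (Module.reflection_inv _).symm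
  · rcases Nat.eq_zero_or_pos (M i j) with h | h
    · rw [h, pow_zero]
    · have h1 := M.off_diagonal i j hij
      refine Module.reflection_mul_reflection_pow_eq_one (θ := Real.pi / M i j) _ _
        (geomCoroot_single i j) ?_ (sin_pi_div_pos (by lia)).ne' ?_
      · rw [geomCoroot_single, M.symmetric]
      · have : (M i j : ℝ) ≠ 0 := by exact_mod_cast h.ne'
        field_simp

theorem coxeterMatrix_dvd_of_simple_mul_simple_pow_eq_one (cs : CoxeterSystem M W) {i j : B}
    {n : ℕ} (h : (cs.simple i * cs.simple j) ^ n = 1) : M i j ∣ n := by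
  rcases eq_or_ne i j with rfl | hij
  · simp
  have h' : (geomReflection M i * geomReflection M j) ^ n = 1 := by
    have := congrArg (cs.lift ⟨_, isLiftable_geomReflection⟩) h
    simpa [cs.lift_apply_simple] using this
  have happ := congrArg (fun T => T (Finsupp.single i (1 : ℝ))) h'
  have hsymm : geomCoroot M j (Finsupp.single i 1) = -2 * Real.cos (Real.pi / M i j) := by
    rw [geomCoroot_single, M.symmetric]
  rcases Nat.eq_zero_or_pos (M i j) with h0 | h0
  · have h₁ := geomCoroot_single (M := M) i j
    simp only [h0, Nat.cast_zero, div_zero, Real.cos_zero, mul_one] at h₁ hsymm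
    simp only [geomReflection,
      Module.reflection_mul_reflection_pow_left_of_parallel _ _ h₁ hsymm] at happ
    have := congrArg (fun v => v j) happ
    simp [hij.symm] at this
    simp [this]
  · have h1 := M.off_diagonal i j hij
    have hs := sin_pi_div_pos (m := M i j) (by lia)
    have hm : (M i j : ℝ) ≠ 0 := by exact_mod_cast h0.ne'
    have h₂ := Module.sin_smul_reflection_mul_reflection_pow_left
      (geomCoroot_single_self (M := M) i) (geomCoroot_single_self j)
      (geomCoroot_single i j) hsymm n
    simp only [geomReflection] at happ
    rw [happ] at h₂
    have hj := congrArg (fun v => v j) h₂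
    have hi := congrArg (fun v => v i) h₂
    simp [hij, hij.symm] at hi hj
    -- With `θ = π / M i j`, the two coordinates say `sin (2nθ) = 0` and `sin ((2n + 1)θ) = sin θ`.
    have hcos : Real.cos (2 * n * (Real.pi / M i j)) = 1 := by
      rw [add_mul, Real.sin_add, ← hj, one_mul] at hi
      apply mul_right_cancel₀ hs.ne'
      linarith
    obtain ⟨k, hk⟩ := (Real.cos_eq_one_iff _).1 hcos
    have hkn : (k * M i j : ℝ) = n := by
      field_simp at hk
      have := Real.pi_pos
      nlinarith
    exact Int.natCast_dvd_natCast.1 ⟨k, by rw [mul_comm]; exact_mod_cast hkn.symm⟩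

end CoxeterSystem

/-! ### Inversion parity, the exchange condition and Matsumoto's theorem. -/

namespace CoxeterSystem

variable {B W : Type*} [Group W] {M : CoxeterMatrix B}

open Classical in
/-- The involution `(t, ε) ↦ (sᵢ t sᵢ, ε + [t = sᵢ])` of `W × ℤ/2`. -/
noncomputable def parityPerm (cs : CoxeterSystem M W) (i : B) : Equiv.Perm (W × ZMod 2) :=
  Function.Involutive.toPerm
    (fun p => (cs.simple i * p.1 * cs.simple i, p.2 + if p.1 = cs.simple i then 1 else 0)) (by
      rintro ⟨t, ε⟩
      have h : cs.simple i * t * cs.simple i = cs.simple i ↔ t = cs.simple i := by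
        constructor
        · intro h
          have := congrArg (fun x => cs.simple i * x * cs.simple i) h
          simpa [mul_assoc] using this
        · rintro rfl
          simp
      by_cases ht : t = cs.simple i
      · subst ht
        simp [add_assoc, CharTwo.add_self_eq_zero]
      · simp only [h, ht, if_false, add_zero]
        simp [mul_assoc])

open Classical in
theorem parityPerm_apply (cs : CoxeterSystem M W) (i : B) (t : W) (ε : ZMod 2) :
    cs.parityPerm i (t, ε) =
      (cs.simple i * t * cs.simple i, ε + if t = cs.simple i then 1 else 0) := rfl

theorem simple_mul_pow_simple_mul_simple (cs : CoxeterSystem M W) (i j : B) (n : ℕ) :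
    cs.simple j * (cs.simple i * cs.simple j) ^ n =
      ((cs.simple i * cs.simple j) ^ n)⁻¹ * cs.simple j := by
  induction n with
  | zero => simp
  | succ n ih =>
    rw [pow_succ, ← mul_assoc, ih, ← pow_succ, pow_succ', mul_inv_rev]
    simp [mul_assoc]

open Classical in
theorem parityPerm_mul_pow_apply (cs : CoxeterSystem M W) (i j : B) (n : ℕ) (t : W) (ε : ZMod 2) :
    ((cs.parityPerm i * cs.parityPerm j) ^ n) (t, ε) =
      ((cs.simple i * cs.simple j) ^ n * t * ((cs.simple i * cs.simple j) ^ n)⁻¹,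
        ε + ∑ k ∈ Finset.range (2 * n),
          if t = cs.simple j * (cs.simple i * cs.simple j) ^ k then 1 else 0) := by
  induction n with
  | zero => simp
  | succ n ih =>
    rw [pow_succ', Equiv.Perm.mul_apply, ih, Equiv.Perm.mul_apply, parityPerm_apply,
      parityPerm_apply, show 2 * (n + 1) = 2 * n + 1 + 1 by ring, Finset.sum_range_succ,
      Finset.sum_range_succ]
    set r := cs.simple i * cs.simple j with hr
    have hrj (k : ℕ) := cs.simple_mul_pow_simple_mul_simple i j k
    rw [← hr] at hrj
    have h₁ : r ^ n * t * (r ^ n)⁻¹ = cs.simple j ↔ t = cs.simple j * r ^ (2 * n) := by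
      rw [two_mul, pow_add, ← mul_assoc, hrj, mul_inv_eq_iff_eq_mul, mul_assoc _ (cs.simple j),
        eq_inv_mul_iff_mul_eq]
    have h₂ : cs.simple j * (r ^ n * t * (r ^ n)⁻¹) * cs.simple j = cs.simple i ↔
        t = cs.simple j * r ^ (2 * n + 1) := by
      have : cs.simple j * r ^ (2 * n + 1) = (r ^ n)⁻¹ * (cs.simple j * r) * r ^ n := by
        rw [show 2 * n + 1 = n + (1 + n) by ring, pow_add, pow_add, pow_one, ← mul_assoc, hrj]
        simp only [mul_assoc]
      rw [this, mul_assoc _ _ (r ^ n), eq_inv_mul_iff_mul_eq, ← mul_inv_eq_iff_eq_mul]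
      rw [← mul_right_inj (cs.simple j), ← mul_left_inj (cs.simple j)]
      simp [hr, mul_assoc]
    simp only [h₁, h₂, Prod.mk.injEq]
    refine ⟨?_, by simp only [add_assoc]⟩
    rw [pow_succ', mul_inv_rev, hr, mul_inv_rev]
    simp [mul_assoc]

/-- For `n = M i j` the powers of `s_i s_j` repeat with period `n`, so the `2n` contributions to the
bit cancel in pairs modulo 2. -/
theorem isLiftable_parityPerm (cs : CoxeterSystem M W) : M.IsLiftable cs.parityPerm := by
  classical
  intro i j
  ext1 ⟨t, ε⟩
  rw [parityPerm_mul_pow_apply, two_mul, Finset.sum_range_add]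
  simp [pow_add, CharTwo.add_self_eq_zero]

/-- The action of `W` on `W × ℤ/2` recording the parity of the inversions. -/
noncomputable def parityHom (cs : CoxeterSystem M W) : W →* Equiv.Perm (W × ZMod 2) :=
  cs.lift ⟨_, cs.isLiftable_parityPerm⟩

open Classical in
-- Consequently the parity of the multiplicity of `t` in the inversion sequence depends only on the
-- group element, not on the word.
theorem parityHom_wordProd_apply (cs : CoxeterSystem M W) (ω : List B) (t : W) (ε : ZMod 2) :
    cs.parityHom (cs.wordProd ω) (t, ε) =
      (cs.wordProd ω * t * (cs.wordProd ω)⁻¹, ε + ((cs.rightInvSeq ω).count t : ZMod 2)) := by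
  induction ω with
  | nil => simp
  | cons i ω ih =>
    rw [wordProd_cons, map_mul, Equiv.Perm.mul_apply, ih]
    simp only [parityHom, cs.lift_apply_simple, parityPerm_apply, rightInvSeq, List.count_cons,
      beq_iff_eq, Prod.mk.injEq, mul_inv_rev, inv_simple]
    refine ⟨by simp only [mul_assoc], ?_⟩
    have : cs.wordProd ω * t * (cs.wordProd ω)⁻¹ = cs.simple i ↔
        (cs.wordProd ω)⁻¹ * cs.simple i * cs.wordProd ω = t := by
      rw [mul_inv_eq_iff_eq_mul, mul_assoc, inv_mul_eq_iff_eq_mul, eq_comm]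
    simp only [this]
    push_cast
    ring

/-- Let `w` be the element spelled by `ω`. If `s_i` were missing, the parity count would put it an
odd number of times in the inversion sequence of a reduced word of `w s_i`; then `w` would be
shorter than `w s_i`. -/
theorem mem_rightInvSeq_of_isRightDescent (cs : CoxeterSystem M W) {ω : List B} {i : B}
    (h : cs.IsRightDescent (cs.wordProd ω) i) : cs.simple i ∈ cs.rightInvSeq ω := by
  classical
  by_contra hmem
  obtain ⟨τ, hτ, hτw⟩ := cs.exists_isReduced (cs.wordProd ω * cs.simple i)
  have h₁ := cs.parityHom_wordProd_apply τ (cs.simple i) 0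
  rw [← hτw, map_mul, Equiv.Perm.mul_apply, parityHom, cs.lift_apply_simple, parityPerm_apply,
    ← parityHom, parityHom_wordProd_apply, simple_mul_simple_self, one_mul,
    List.count_eq_zero_of_not_mem hmem] at h₁
  have h₂ : cs.simple i ∈ cs.rightInvSeq τ := by
    by_contra hmem'
    rw [List.count_eq_zero_of_not_mem hmem'] at h₁
    simp at h₁
  have h₃ := (cs.isRightInversion_of_mem_rightInvSeq hτ h₂).2
  rw [← hτw] at h₃
  simp only [simple_mul_simple_cancel_right] at h₃
  exact lt_asymm h h₃

/-- The exchange condition. -/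
theorem exists_wordProd_eraseIdx (cs : CoxeterSystem M W) {ω : List B} {i : B}
    (h : cs.IsRightDescent (cs.wordProd ω) i) :
    ∃ k < ω.length, cs.wordProd ω * cs.simple i = cs.wordProd (ω.eraseIdx k) := by
  obtain ⟨k, hk, hki⟩ := List.mem_iff_getElem.mp (cs.mem_rightInvSeq_of_isRightDescent h)
  refine ⟨k, by simpa using hk, ?_⟩
  rw [← wordProd_mul_getD_rightInvSeq, List.getD_eq_getElem _ 1 hk, hki]

/-- Exchange in the word `i :: ω` for `s_i w`: erasing the head gives the claim, while erasing a
letter of `ω` would make `w s_j` shorter than `w`. -/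
theorem simple_mul_eq_mul_simple_of_length_lt (cs : CoxeterSystem M W) {w : W} {i j : B}
    (h : cs.length (cs.simple i * w * cs.simple j) = cs.length w)
    (hi : cs.length w < cs.length (cs.simple i * w))
    (hj : cs.length w < cs.length (w * cs.simple j)) :
    cs.simple i * w = w * cs.simple j := by
  obtain ⟨ω, hω, rfl⟩ := cs.exists_isReduced w
  obtain ⟨k, hk, hkw⟩ := cs.exists_wordProd_eraseIdx (ω := i :: ω) (i := j)
    (by rw [IsRightDescent, wordProd_cons, h]; exact hi)
  rw [wordProd_cons] at hkw
  rcases k with _ | k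
  · simp only [List.eraseIdx_cons_zero] at hkw
    conv_rhs => rw [← hkw]
    simp
  · simp only [List.eraseIdx_cons_succ, wordProd_cons, mul_assoc, mul_right_inj] at hkw
    have h₁ := cs.length_wordProd_le (ω.eraseIdx k)
    simp only [List.length_cons] at hk
    rw [← hkw, List.length_eraseIdx_of_lt (by lia)] at h₁
    rw [hω.eq] at hj
    lia

/-- If `ℓ(sᵢ w sⱼ) = ℓ(w)` and `ℓ(sᵢ w) = ℓ(w sⱼ)`, then `sᵢ w = w sⱼ`. -/
theorem simple_mul_eq_mul_simple (cs : CoxeterSystem M W) {w : W} {i j : B}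
    (h : cs.length (cs.simple i * w * cs.simple j) = cs.length w)
    (hij : cs.length (cs.simple i * w) = cs.length (w * cs.simple j)) :
    cs.simple i * w = w * cs.simple j := by
  rcases lt_or_gt_of_ne (cs.length_simple_mul_ne w i) with hi | hi
  · have := cs.simple_mul_eq_mul_simple_of_length_lt (w := cs.simple i * w) (i := i) (j := j)
      (by simpa using hij.symm) (by simpa using hi) (by rw [h]; exact hi)
    rw [simple_mul_simple_cancel_left] at this
    conv_rhs => rw [this]
    simp
  · exact cs.simple_mul_eq_mul_simple_of_length_lt h hi (hij ▸ hi)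

theorem exists_of_mem_rightInvSeq_alternatingWord (cs : CoxeterSystem M W) {i j : B} {n : ℕ}
    {t : W} (h : t ∈ cs.rightInvSeq (alternatingWord i j n)) :
    ∃ l < n, t = cs.simple j * (cs.simple i * cs.simple j) ^ l := by
  induction n generalizing i j t with
  | zero => simp [alternatingWord] at h
  | succ n ih =>
    rw [alternatingWord_succ, rightInvSeq_concat] at h
    simp only [List.concat_eq_append, List.mem_append, List.mem_map, List.mem_singleton] at h
    rcases h with ⟨u, hu, rfl⟩ | rfl
    · obtain ⟨l, hl, rfl⟩ := ih hu
      refine ⟨l + 1, by lia, ?_⟩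
      rw [MulAut.conj_apply, inv_simple, mul_assoc, mul_assoc, pow_succ,
        ← mul_assoc (cs.simple i), ← mul_pow_mul, mul_assoc]
    · exact ⟨0, by lia, by simp⟩

/-- A failure at the last letter yields `(s_i s_j)^(l+1) = 1` with `l + 1` below `M i j` (or `M i j
= 0`), against the exact order. -/
theorem isReduced_alternatingWord (cs : CoxeterSystem M W) {i j : B} (hij : i ≠ j) {n : ℕ}
    (hn : M i j = 0 ∨ n ≤ M i j) : cs.IsReduced (alternatingWord i j n) := by
  induction n generalizing i j with
  | zero => simp [IsReduced, alternatingWord]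
  | succ n ih =>
    have hji : cs.IsReduced (alternatingWord j i n) := by
      apply ih hij.symm
      rw [M.symmetric]
      lia
    rw [alternatingWord_succ, IsReduced, wordProd_concat, List.length_concat, ← hji.eq,
      ← cs.not_isRightDescent_iff]
    intro hdesc
    obtain ⟨l, hl, heq⟩ := cs.exists_of_mem_rightInvSeq_alternatingWord
      (cs.mem_rightInvSeq_of_isRightDescent hdesc)
    have h₁ : (cs.simple i * cs.simple j) ^ (l + 1) = 1 := by
      have := congrArg (fun x => cs.simple j * x) heq
      simp only [simple_mul_simple_self] at this
      rw [← inv_inj, ← inv_pow, mul_inv_rev, inv_simple, inv_simple, inv_one, pow_succ', mul_assoc]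
      exact this.symm
    have h₂ := cs.coxeterMatrix_dvd_of_simple_mul_simple_pow_eq_one h₁
    rcases hn with h0 | hn
    · rw [h0] at h₂
      simp at h₂
    · have := Nat.le_of_dvd (by lia) h₂
      lia

/-- Grow the alternating tail one letter at a time: exchange must erase a letter of the prefix,
since the lengthened tail is itself reduced. -/
theorem exists_isReduced_append_alternatingWord (cs : CoxeterSystem M W) {w : W} {i j : B}
    (hij : i ≠ j) (hi : cs.IsRightDescent w i) (hj : cs.IsRightDescent w j) {n : ℕ}
    (hn : M i j = 0 ∨ n ≤ M i j) :
    ∃ ω, cs.IsReduced (ω ++ alternatingWord i j n) ∧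
      w = cs.wordProd (ω ++ alternatingWord i j n) := by
  induction n generalizing i j with
  | zero =>
    obtain ⟨ω, hω, hw⟩ := cs.exists_isReduced w
    exact ⟨ω, by simpa [alternatingWord] using hω, by simpa [alternatingWord] using hw⟩
  | succ n ih =>
    obtain ⟨ω, hω, hw⟩ := ih hij.symm hj hi (by rw [M.symmetric]; lia)
    obtain ⟨k, hk, hkw⟩ := cs.exists_wordProd_eraseIdx (hw ▸ hj)
    by_cases hkω : k < ω.length
    · have hw' : w = cs.wordProd (ω.eraseIdx k ++ alternatingWord i j (n + 1)) := by
        rw [List.eraseIdx_append_of_lt_length hkω] at hkw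
        rw [alternatingWord_succ, List.concat_eq_append, ← List.append_assoc,
          ← List.concat_eq_append, wordProd_concat, ← hkw, ← hw]
        simp
      refine ⟨ω.eraseIdx k, ?_, hw'⟩
      have := hω.eq
      rw [← hw] at this
      rw [IsReduced, ← hw', this]
      simp [List.length_eraseIdx_of_lt hkω]
      lia
    · exfalso
      have hred := cs.isReduced_alternatingWord hij hn
      rw [List.eraseIdx_append_of_length_le (by lia), wordProd_append, wordProd_append, mul_assoc,
        mul_right_inj, ← wordProd_concat, ← alternatingWord_succ] at hkw
      have h₁ := cs.length_wordProd_le ((alternatingWord j i n).eraseIdx (k - ω.length))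
      rw [← hkw, hred.eq] at h₁
      have h₂ := List.length_eraseIdx_le (alternatingWord j i n) (k - ω.length)
      simp at h₁ h₂
      lia

theorem IsReduced.isRightDescent_of_append_singleton {cs : CoxeterSystem M W} {ω : List B} {i : B}
    (h : cs.IsReduced (ω ++ [i])) : cs.IsRightDescent (cs.wordProd (ω ++ [i])) i := by
  rw [IsRightDescent, h.eq, wordProd_append, wordProd_singleton, simple_mul_simple_cancel_right]
  have := cs.length_wordProd_le ω
  simp
  lia

/-- **Matsumoto's theorem**: a product over a reduced word of elements of a monoid that satisfy
the braid relations depends only on the element of `W` represented by the word. -/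
theorem prod_map_eq_of_isReduced (cs : CoxeterSystem M W) {G : Type*} [Monoid G] {f : B → G}
    (hf : ∀ i j, ((braidWord M i j).map f).prod = ((braidWord M j i).map f).prod)
    {ω τ : List B} (hω : cs.IsReduced ω) (hτ : cs.IsReduced τ)
    (h : cs.wordProd ω = cs.wordProd τ) : (ω.map f).prod = (τ.map f).prod := by
  have hlen : ω.length = τ.length := by rw [← hω.eq, ← hτ.eq, h]
  obtain ⟨n, hn⟩ : ∃ n, ω.length = n := ⟨_, rfl⟩
  induction n generalizing ω τ with
  | zero =>
    obtain rfl := List.length_eq_zero_iff.1 hn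
    obtain rfl := List.length_eq_zero_iff.1 (hlen.symm.trans hn)
    rfl
  | succ n ih =>
    have same : ∀ {ω τ : List B} {i : B}, cs.IsReduced (ω ++ [i]) → cs.IsReduced (τ ++ [i]) →
        cs.wordProd (ω ++ [i]) = cs.wordProd (τ ++ [i]) → (ω ++ [i]).length = n + 1 →
        ((ω ++ [i]).map f).prod = ((τ ++ [i]).map f).prod := by
      intro ω τ i hω hτ h hn
      have hl : ω.length = τ.length := by
        have := hω.eq
        rw [h, hτ.eq] at this
        simpa using this.symm
      have hω' : cs.IsReduced ω := by simpa using hω.take ω.length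
      have hτ' : cs.IsReduced τ := by simpa using hτ.take τ.length
      rw [List.map_append, List.map_append, List.prod_append, List.prod_append,
        ih hω' hτ' (by simpa [wordProd_append] using h) hl (by simpa using hn)]
    rcases List.eq_nil_or_concat' ω with rfl | ⟨ω, i, rfl⟩
    · simp at hn
    rcases List.eq_nil_or_concat' τ with rfl | ⟨τ, j, rfl⟩
    · simp at hlen
    rcases eq_or_ne i j with rfl | hij
    · exact same hω hτ h hn
    have hi := hω.isRightDescent_of_append_singleton
    have hj := hτ.isRightDescent_of_append_singleton
    rw [← h] at hj
    -- With `M i j = 0` there would be a reduced word with an alternating tail of length `n + 2`,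
    -- longer than the word's length `n + 1`.
    have hM : M i j ≠ 0 := by
      intro h0
      obtain ⟨u, hu, huw⟩ := cs.exists_isReduced_append_alternatingWord hij hi hj (n := n + 2)
        (Or.inl h0)
      have := hu.eq
      rw [← huw, hω.eq, hn] at this
      simp at this
      lia
    -- The element has reduced words `u` followed by either braid word, one ending in `i` and one in
    -- `j`. `same` compares them with the given words, and the braid relation links them to each
    -- other.
    obtain ⟨u, hu, huw⟩ := cs.exists_isReduced_append_alternatingWord hij hi hj (n := M i j)
      (Or.inr le_rfl)
    have hbraid := cs.wordProd_braidWord_eq i j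
    have hfb := hf i j
    rw [braidWord, braidWord, M.symmetric j i] at hbraid hfb
    have huw' : cs.wordProd (ω ++ [i]) = cs.wordProd (u ++ alternatingWord j i (M i j)) := by
      rw [huw, wordProd_append, wordProd_append, hbraid]
    have hu' : cs.IsReduced (u ++ alternatingWord j i (M i j)) := by
      rw [IsReduced, ← huw', huw, hu.eq]
      simp
    obtain ⟨m, hm⟩ := Nat.exists_eq_succ_of_ne_zero hM
    rw [hm, Nat.succ_eq_add_one] at hu hu' huw huw' hfb
    rw [alternatingWord_succ, List.concat_eq_append] at hu hu' huw huw'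
    rw [← List.append_assoc] at hu hu' huw huw'
    rw [same hω hu' huw' hn, same hτ hu (h ▸ huw) (hlen ▸ hn)]
    rw [alternatingWord_succ, alternatingWord_succ, List.concat_eq_append,
      List.concat_eq_append] at hfb
    simp only [List.append_assoc, List.map_append, List.prod_append] at hfb ⊢
    rw [hfb]

end CoxeterSystem

/-! ### Commuting left and right multiplications on the free module over `W`. -/

namespace CoxeterSystem

variable {B W : Type*} [Group W] {M : CoxeterMatrix B}
variable {A : Type*} [CommRing A]

open Classical in
/-- The product `gᵢ g_w` expanded in the free module with basis `W`. -/
noncomputable def leftOpBasis (cs : CoxeterSystem M W) (a : B → Aˣ) (i : B) (w : W) : W →₀ A :=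
  if cs.IsLeftDescent w i then
    (a i : A) • Finsupp.single (cs.simple i * w) 1 + (1 - (a i : A)) • Finsupp.single w 1
  else Finsupp.single (cs.simple i * w) 1

theorem leftOpBasis_of_isLeftDescent {cs : CoxeterSystem M W} (a : B → Aˣ) {i : B} {w : W}
    (h : cs.IsLeftDescent w i) :
    cs.leftOpBasis a i w =
      (a i : A) • Finsupp.single (cs.simple i * w) 1 + (1 - (a i : A)) • Finsupp.single w 1 :=
  if_pos h

theorem leftOpBasis_of_not_isLeftDescent {cs : CoxeterSystem M W} (a : B → Aˣ) {i : B} {w : W}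
    (h : ¬cs.IsLeftDescent w i) :
    cs.leftOpBasis a i w = Finsupp.single (cs.simple i * w) 1 :=
  if_neg h

variable [MulSemiringAction W A]

/-- The condition `(1 - aᵢ)(1 - ρᵢ) = 0` for all `i`, written elementwise. -/
def AnnihilatesDifferences (cs : CoxeterSystem M W) (a : B → Aˣ) : Prop :=
  ∀ (i : B) (c : A), (1 - (a i : A)) * (cs.simple i • c) = (1 - (a i : A)) * c

theorem IsEquivariant.simple_smul {cs : CoxeterSystem M W} {a : B → Aˣ} (ha : cs.IsEquivariant a)
    (i : B) : cs.simple i • (a i : A) = a i :=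
  ha i i _ (by simp)

open Classical in
/-- The product `g_w gⱼ` expanded in the free module with basis `W`. -/
noncomputable def rightOpBasis (cs : CoxeterSystem M W) (a : B → Aˣ) (j : B) (w : W) : W →₀ A :=
  if cs.IsRightDescent w j then
    (w • (a j : A)) • Finsupp.single (w * cs.simple j) 1
      + (1 - w • (a j : A)) • Finsupp.single w 1
  else Finsupp.single (w * cs.simple j) 1

/-- Left multiplication by `gᵢ` on the free module with basis `W`. -/
noncomputable def leftOp (cs : CoxeterSystem M W) (a : B → Aˣ) (i : B) :
    AddMonoid.End (W →₀ A) :=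
  Finsupp.liftAddHom fun w =>
    ((LinearMap.toSpanSingleton A (W →₀ A) (cs.leftOpBasis a i w)).toAddMonoidHom).comp
      (DistribSMul.toAddMonoidHom A (cs.simple i))

/-- Right multiplication by `gⱼ` on the free module with basis `W`. -/
noncomputable def rightOp (cs : CoxeterSystem M W) (a : B → Aˣ) (j : B) :
    (W →₀ A) →ₗ[A] (W →₀ A) :=
  Finsupp.linearCombination A (cs.rightOpBasis a j)

variable (cs : CoxeterSystem M W) (a : B → Aˣ)

theorem leftOp_single (i : B) (w : W) (c : A) :
    cs.leftOp a i (Finsupp.single w c) = (cs.simple i • c) • cs.leftOpBasis a i w := by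
  erw [Finsupp.liftAddHom_apply_single]
  rfl

theorem leftOp_single_one (i : B) (w : W) :
    cs.leftOp a i (Finsupp.single w 1) = cs.leftOpBasis a i w := by
  rw [leftOp_single, smul_one, one_smul]

theorem rightOp_single_one (j : B) (w : W) :
    cs.rightOp a j (Finsupp.single w 1) = cs.rightOpBasis a j w := by
  simp [rightOp]

theorem leftOp_smul (i : B) (c : A) (v : W →₀ A) :
    cs.leftOp a i (c • v) = (cs.simple i • c) • cs.leftOp a i v := by
  induction v using Finsupp.induction_linear with
  | zero => simp
  | add v v' h h' => rw [smul_add, map_add, h, h', map_add, smul_add]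
  | single w d => rw [Finsupp.smul_single, leftOp_single, leftOp_single, smul_eq_mul, smul_mul',
      smul_smul]

variable {cs} in
theorem rightOpBasis_of_isRightDescent {j : B} {w : W} (h : cs.IsRightDescent w j) :
    cs.rightOpBasis a j w = (w • (a j : A)) • Finsupp.single (w * cs.simple j) 1
      + (1 - w • (a j : A)) • Finsupp.single w 1 :=
  if_pos h

variable {cs} in
theorem rightOpBasis_of_not_isRightDescent {j : B} {w : W} (h : ¬cs.IsRightDescent w j) :
    cs.rightOpBasis a j w = Finsupp.single (w * cs.simple j) 1 :=
  if_neg h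

variable {cs a}

theorem leftOp_leftOpBasis (ha : cs.IsEquivariant a) (i : B) (w : W) :
    cs.leftOp a i (cs.leftOpBasis a i w) =
      (a i : A) • Finsupp.single w 1 + (1 - (a i : A)) • cs.leftOpBasis a i w := by
  by_cases h : cs.IsLeftDescent w i
  · have h' := cs.isLeftDescent_iff_not_isLeftDescent_mul.1 h
    conv_lhs => rw [leftOpBasis_of_isLeftDescent a h]
    rw [map_add, leftOp_smul, leftOp_smul, leftOp_single_one, leftOp_single_one,
      leftOpBasis_of_not_isLeftDescent a h', simple_mul_simple_cancel_left, smul_sub, smul_one,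
      ha.simple_smul]
  · have h' : cs.IsLeftDescent (cs.simple i * w) i := by
      rw [cs.isLeftDescent_iff_not_isLeftDescent_mul, simple_mul_simple_cancel_left]
      exact h
    rw [leftOpBasis_of_not_isLeftDescent a h, leftOp_single_one, leftOpBasis_of_isLeftDescent a h',
      simple_mul_simple_cancel_left]

/-- On `c e_w` the two sides carry `(1 - a_i) c` and `(1 - a_i)(s_i.c)`; the annihilation condition
identifies them. -/
theorem leftOp_leftOp (ha : cs.IsEquivariant a) (hd : cs.AnnihilatesDifferences a) (i : B)
    (v : W →₀ A) :
    cs.leftOp a i (cs.leftOp a i v) = (a i : A) • v + (1 - (a i : A)) • cs.leftOp a i v := by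
  induction v using Finsupp.induction_linear with
  | zero => simp
  | add v v' h h' => rw [map_add, map_add, h, h']; module
  | single w c =>
    rw [leftOp_single, leftOp_smul, leftOp_leftOpBasis ha, smul_smul (1 - (a i : A)), hd,
      smul_smul, simple_mul_simple_self, one_smul, smul_add, smul_smul, smul_smul, mul_comm c,
      mul_comm c, ← Finsupp.smul_single_one w c, smul_smul]

/-- If the descent changed, the lengths would meet the hypotheses of `simple_mul_eq_mul_simple`. -/
theorem isLeftDescent_mul_simple_iff {i j : B} {w : W} (h : cs.simple i * w ≠ w * cs.simple j) :
    cs.IsLeftDescent (w * cs.simple j) i ↔ cs.IsLeftDescent w i := by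
  have h₁ := cs.length_simple_mul w i
  have h₂ := cs.length_mul_simple w j
  have h₃ := cs.length_mul_simple (cs.simple i * w) j
  have h₄ := cs.length_simple_mul (w * cs.simple j) i
  have h₅ := mt (cs.simple_mul_eq_mul_simple (w := w) (i := i) (j := j))
  simp only [IsLeftDescent, mul_assoc] at *
  grind

theorem isRightDescent_simple_mul_iff {i j : B} {w : W} (h : cs.simple i * w ≠ w * cs.simple j) :
    cs.IsRightDescent (cs.simple i * w) j ↔ cs.IsRightDescent w j := by
  have h₁ := cs.length_simple_mul w i
  have h₂ := cs.length_mul_simple w j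
  have h₃ := cs.length_mul_simple (cs.simple i * w) j
  have h₄ := cs.length_simple_mul (w * cs.simple j) i
  have h₅ := mt (cs.simple_mul_eq_mul_simple (w := w) (i := i) (j := j))
  simp only [IsRightDescent, mul_assoc] at *
  grind

theorem rightOpBasis_eq_leftOpBasis (ha : cs.IsEquivariant a) {i j : B} {w : W}
    (h : cs.simple i * w = w * cs.simple j) : cs.rightOpBasis a j w = cs.leftOpBasis a i w := by
  have haw : w • (a j : A) = a i := ha j i w (by rw [← h]; simp)
  unfold rightOpBasis leftOpBasis IsRightDescent IsLeftDescent
  simp only [h, haw]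

/-- This is the associativity `g_i (g_w g_j) = (g_i g_w) g_j`. If `s_i w = w s_j`, equivariance
makes both operators agree on `e_w`; otherwise left and right descents are independent of each
other. -/
theorem leftOp_rightOpBasis (ha : cs.IsEquivariant a) (hd : cs.AnnihilatesDifferences a) (i j : B)
    (w : W) :
    cs.leftOp a i (cs.rightOpBasis a j w) = cs.rightOp a j (cs.leftOpBasis a i w) := by
  by_cases h : cs.simple i * w = w * cs.simple j
  · have h' : cs.simple i * (cs.simple i * w) = cs.simple i * w * cs.simple j := by
      rw [mul_assoc, ← h]
    have haw : w • (a j : A) = a i := ha j i w (by rw [← h]; simp)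
    have e₁ := rightOpBasis_eq_leftOpBasis ha h
    have e₂ := rightOpBasis_eq_leftOpBasis ha h'
    rw [e₁]
    by_cases hw : cs.IsLeftDescent w i
    · rw [leftOpBasis_of_isLeftDescent a hw, map_add, map_add, leftOp_smul, leftOp_smul, map_smul,
        map_smul, leftOp_single_one, leftOp_single_one, rightOp_single_one, rightOp_single_one,
        e₁, e₂, smul_sub, smul_one, ha.simple_smul]
    · rw [leftOpBasis_of_not_isLeftDescent a hw, leftOp_single_one, rightOp_single_one, e₂]
  · have hl := isLeftDescent_mul_simple_iff h
    have hr := isRightDescent_simple_mul_iff h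
    by_cases hw : cs.IsLeftDescent w i <;> by_cases hw' : cs.IsRightDescent w j
    · rw [leftOpBasis_of_isLeftDescent a hw, rightOpBasis_of_isRightDescent a hw', map_add,
        map_add, leftOp_smul, leftOp_smul, map_smul, map_smul, leftOp_single_one,
        leftOp_single_one, rightOp_single_one, rightOp_single_one,
        leftOpBasis_of_isLeftDescent a hw, leftOpBasis_of_isLeftDescent a (hl.2 hw),
        rightOpBasis_of_isRightDescent a hw', rightOpBasis_of_isRightDescent a (hr.2 hw'),
        smul_sub, smul_one, mul_smul, mul_assoc]
      -- With both descents present, the sides differ by terms `(1 - a_i)(s_i.(w.a_j) - w.a_j)`,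
      -- which the condition kills.
      have := hd i (w • (a j : A))
      match_scalars
      · ring
      · linear_combination this
      · ring
      · linear_combination -this
    · rw [leftOpBasis_of_isLeftDescent a hw, rightOpBasis_of_not_isRightDescent a hw', map_add,
        map_smul, map_smul, leftOp_single_one, rightOp_single_one, rightOp_single_one,
        leftOpBasis_of_isLeftDescent a (hl.2 hw), rightOpBasis_of_not_isRightDescent a hw',
        rightOpBasis_of_not_isRightDescent a (mt hr.1 hw'), mul_assoc]
    · rw [leftOpBasis_of_not_isLeftDescent a hw, rightOpBasis_of_isRightDescent a hw', map_add,
        leftOp_smul, leftOp_smul, leftOp_single_one, leftOp_single_one, rightOp_single_one,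
        leftOpBasis_of_not_isLeftDescent a hw, leftOpBasis_of_not_isLeftDescent a (mt hl.1 hw),
        rightOpBasis_of_isRightDescent a (hr.2 hw'), smul_sub, smul_one, mul_smul, mul_assoc]
    · rw [leftOpBasis_of_not_isLeftDescent a hw, rightOpBasis_of_not_isRightDescent a hw',
        leftOp_single_one, rightOp_single_one,
        leftOpBasis_of_not_isLeftDescent a (mt hl.1 hw),
        rightOpBasis_of_not_isRightDescent a (mt hr.1 hw'), mul_assoc]

theorem leftOp_rightOp (ha : cs.IsEquivariant a) (hd : cs.AnnihilatesDifferences a) (i j : B)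
    (v : W →₀ A) :
    cs.leftOp a i (cs.rightOp a j v) = cs.rightOp a j (cs.leftOp a i v) := by
  induction v using Finsupp.induction_linear with
  | zero => simp
  | add v v' h h' => rw [map_add, map_add, h, h', map_add, map_add]
  | single w c =>
    rw [← Finsupp.smul_single_one, map_smul, leftOp_smul, leftOp_smul, map_smul,
      leftOp_single_one, rightOp_single_one, leftOp_rightOpBasis ha hd]

theorem prod_leftOp_rightOp (ha : cs.IsEquivariant a) (hd : cs.AnnihilatesDifferences a)
    (ω : List B) (j : B) (v : W →₀ A) :
    (ω.map (cs.leftOp a)).prod (cs.rightOp a j v) =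
      cs.rightOp a j ((ω.map (cs.leftOp a)).prod v) := by
  induction ω with
  | nil => rfl
  | cons i ω ih =>
    rw [List.map_cons, List.prod_cons, AddMonoid.End.coe_mul,
      Function.comp_apply, Function.comp_apply, ih,
      leftOp_rightOp ha hd]

variable (cs a) in
theorem prod_leftOp_smul (ω : List B) (c : A) (v : W →₀ A) :
    (ω.map (cs.leftOp a)).prod (c • v) =
      (cs.wordProd ω • c) • (ω.map (cs.leftOp a)).prod v := by
  induction ω with
  | nil => simp
  | cons i ω ih =>
    rw [List.map_cons, List.prod_cons, AddMonoid.End.coe_mul,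
      Function.comp_apply, Function.comp_apply, ih,
      leftOp_smul, wordProd_cons, mul_smul]

variable (a) in
theorem IsReduced.prod_leftOp_single_one {ω : List B} (hω : cs.IsReduced ω) :
    (ω.map (cs.leftOp a)).prod (Finsupp.single 1 1) = Finsupp.single (cs.wordProd ω) 1 := by
  induction ω with
  | nil => simp
  | cons i ω ih =>
    have hω' : cs.IsReduced ω := by simpa using hω.drop 1
    rw [List.map_cons, List.prod_cons, AddMonoid.End.coe_mul,
      Function.comp_apply, ih hω', leftOp_single_one,
      leftOpBasis_of_not_isLeftDescent, wordProd_cons]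
    rw [not_isLeftDescent_iff, ← wordProd_cons, hω.eq, hω'.eq, List.length_cons]

theorem prod_leftOp_eq_of_isReduced (ha : cs.IsEquivariant a) (hd : cs.AnnihilatesDifferences a)
    {ω τ : List B} (hω : cs.IsReduced ω) (hτ : cs.IsReduced τ)
    (h : cs.wordProd ω = cs.wordProd τ) :
    (ω.map (cs.leftOp a)).prod = (τ.map (cs.leftOp a)).prod := by
  have key : ∀ u : List B, cs.IsReduced u →
      (ω.map (cs.leftOp a)).prod (Finsupp.single (cs.wordProd u) 1) =
        (τ.map (cs.leftOp a)).prod (Finsupp.single (cs.wordProd u) 1) := by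
    intro u
    induction u using List.reverseRecOn with
    | nil =>
      intro _
      rw [wordProd_nil, hω.prod_leftOp_single_one a, hτ.prod_leftOp_single_one a, h]
    | append_singleton u j ih =>
      intro hu
      have hu' : cs.IsReduced u := by simpa using hu.take u.length
      have : Finsupp.single (cs.wordProd (u ++ [j])) (1 : A) =
          cs.rightOp a j (Finsupp.single (cs.wordProd u) 1) := by
        rw [rightOp_single_one, rightOpBasis_of_not_isRightDescent, wordProd_append,
          wordProd_singleton]
        rw [isRightDescent_iff_not_isRightDescent_mul, not_not]
        have := hu.isRightDescent_of_append_singleton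
        rwa [wordProd_append, wordProd_singleton] at this
      rw [this, prod_leftOp_rightOp ha hd, prod_leftOp_rightOp ha hd, ih hu']
  ext1 v
  induction v using Finsupp.induction_linear with
  | zero => simp
  | add v v' h h' => rw [map_add, map_add, h, h']
  | single w c =>
    obtain ⟨u, hu, rfl⟩ := cs.exists_isReduced w
    rw [← Finsupp.smul_single_one, prod_leftOp_smul, prod_leftOp_smul, key u hu, h]

theorem isReduced_braidWord (cs : CoxeterSystem M W) (i j : B) : cs.IsReduced (braidWord M i j) := by
  rcases eq_or_ne i j with rfl | hij
  · simp [braidWord, IsReduced, alternatingWord]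
  · exact cs.isReduced_alternatingWord hij (Or.inr le_rfl)

theorem prod_leftOp_braidWord (ha : cs.IsEquivariant a) (hd : cs.AnnihilatesDifferences a)
    (i j : B) :
    ((braidWord M i j).map (cs.leftOp a)).prod = ((braidWord M j i).map (cs.leftOp a)).prod :=
  prod_leftOp_eq_of_isReduced ha hd (cs.isReduced_braidWord i j) (cs.isReduced_braidWord j i)
    (cs.wordProd_braidWord_eq i j)

end CoxeterSystem

/-! ### Spanning, and the relation forcing the condition. -/

namespace CoxeterSystem

variable {B W : Type*} [Group W] {M : CoxeterMatrix B} (cs : CoxeterSystem M W)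

theorem closure_range_artinGen : Subgroup.closure (Set.range cs.artinGen) = ⊤ :=
  PresentedGroup.closure_range_of _

theorem prod_artinGen_braidWord (i j : B) :
    ((braidWord M i j).map cs.artinGen).prod = ((braidWord M j i).map cs.artinGen).prod := by
  have h : ∀ ω : List B, (ω.map cs.artinGen).prod =
      PresentedGroup.mk cs.braidRelators (ω.map FreeGroup.of).prod := by
    intro ω
    rw [map_list_prod, List.map_map]
    rfl
  rw [h, h]
  exact PresentedGroup.mk_eq_mk_of_mul_inv_mem ⟨(i, j), rfl⟩

variable {cs} in
theorem IsReduced.artinSection_wordProd {ω : List B} (hω : cs.IsReduced ω) :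
    cs.artinSection (cs.wordProd ω) = (ω.map cs.artinGen).prod :=
  cs.prod_map_eq_of_isReduced cs.prod_artinGen_braidWord
    (cs.exists_isReduced (cs.wordProd ω)).choose_spec.1 hω
    (cs.exists_isReduced (cs.wordProd ω)).choose_spec.2.symm

theorem artinSection_one : cs.artinSection 1 = 1 := by
  have : cs.IsReduced [] := by simp [IsReduced]
  simpa using this.artinSection_wordProd

theorem artinSection_simple (i : B) : cs.artinSection (cs.simple i) = cs.artinGen i := by
  have : cs.IsReduced [i] := by simp [IsReduced]
  simpa using this.artinSection_wordProd

theorem artinSection_mul_artinGen {w : W} {i : B} (h : ¬cs.IsRightDescent w i) :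
    cs.artinSection w * cs.artinGen i = cs.artinSection (w * cs.simple i) := by
  obtain ⟨ω, hω, rfl⟩ := cs.exists_isReduced w
  have hωi : cs.IsReduced (ω ++ [i]) := by
    rw [not_isRightDescent_iff, hω.eq] at h
    rw [IsReduced, wordProd_append, wordProd_singleton, h]
    simp
  rw [hω.artinSection_wordProd, ← wordProd_singleton, ← wordProd_append,
    hωi.artinSection_wordProd]
  simp

variable {A : Type*} [CommRing A] [MulSemiringAction W A]

section Spanning

variable (a : B → Aˣ)

/-- The canonical map from the Artin group to the Marin ring. -/
noncomputable def artinToMarin : cs.ArtinGroup →* cs.MarinRing a :=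
  (Ideal.Quotient.mk (cs.heckeIdeal a).asIdeal : cs.CrossedProduct A →* cs.MarinRing a).comp
    (SkewMonoidAlgebra.of A cs.ArtinGroup)

/-- The canonical map from the coefficient ring to the Marin ring. -/
noncomputable def coeffToMarin : A →+* cs.MarinRing a :=
  (Ideal.Quotient.mk (cs.heckeIdeal a).asIdeal).comp SkewMonoidAlgebra.singleOneRingHom

theorem coeffToMarin_mul (c : A) (x : cs.MarinRing a) : cs.coeffToMarin a c * x = c • x := by
  obtain ⟨y, rfl⟩ := Ideal.Quotient.mk_surjective x
  have h : SkewMonoidAlgebra.single (1 : cs.ArtinGroup) c * y = c • y := by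
    rw [← smul_one_mul c y, SkewMonoidAlgebra.one_def, SkewMonoidAlgebra.smul_single, smul_eq_mul,
      mul_one]
  exact congrArg (Ideal.Quotient.mk (cs.heckeIdeal a).asIdeal) h

theorem marin_smul_mul (c : A) (x y : cs.MarinRing a) : c • x * y = c • (x * y) := by
  rw [← coeffToMarin_mul, mul_assoc, coeffToMarin_mul]

theorem artinToMarin_mul_coeffToMarin (b : cs.ArtinGroup) (c : A) :
    cs.artinToMarin a b * cs.coeffToMarin a c = (cs.artinProj b • c) • cs.artinToMarin a b := by
  rw [← coeffToMarin_mul]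
  change Ideal.Quotient.mk _ (SkewMonoidAlgebra.single b 1 * SkewMonoidAlgebra.single 1 c) =
    Ideal.Quotient.mk _
      (SkewMonoidAlgebra.single 1 (cs.artinProj b • c) * SkewMonoidAlgebra.single b 1)
  rw [SkewMonoidAlgebra.single_mul_single, SkewMonoidAlgebra.single_mul_single]
  simp [artinGroup_smul_def]

theorem artinToMarin_artinGen_mul_self (i : B) :
    cs.artinToMarin a (cs.artinGen i) * cs.artinToMarin a (cs.artinGen i) =
      (a i : A) • 1 + (1 - (a i : A)) • cs.artinToMarin a (cs.artinGen i) := by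
  have h : Ideal.Quotient.mk (cs.heckeIdeal a).asIdeal (cs.heckeRelator a i) = 0 := by
    rw [Ideal.Quotient.eq_zero_iff_mem, TwoSidedIdeal.mem_asIdeal]
    exact TwoSidedIdeal.subset_span ⟨i, rfl⟩
  rw [← coeffToMarin_mul, ← coeffToMarin_mul, mul_one, ← pow_two, ← sub_eq_zero, ← sub_sub]
  rw [heckeRelator, map_sub, map_sub, map_mul, map_pow] at h
  exact h

/-- The quadratic relation reads `(g_i - (1 - a_i)) g_i = a_i`, and `a_i` is a unit. -/
theorem artinToMarin_artinGen_inv (i : B) :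
    cs.artinToMarin a (cs.artinGen i)⁻¹ =
      cs.coeffToMarin a ↑(a i)⁻¹ *
        (cs.artinToMarin a (cs.artinGen i) - cs.coeffToMarin a (1 - (a i : A))) := by
  have h := cs.artinToMarin_artinGen_mul_self a i
  rw [← coeffToMarin_mul, ← coeffToMarin_mul, mul_one, ← sub_eq_iff_eq_add, ← sub_mul] at h
  have h' := congrArg (· * cs.artinToMarin a (cs.artinGen i)⁻¹) h
  simp only [mul_assoc, ← map_mul, mul_inv_cancel, map_one, mul_one] at h'
  rw [h', ← mul_assoc, ← map_mul, Units.inv_mul, map_one, one_mul]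

theorem marinG_eq (w : W) : cs.marinG a w = cs.artinToMarin a (cs.artinSection w) := rfl

/-- At a descent, `g_w = g_{w s_i} g_i`; apply the quadratic relation and move its coefficients to
the left, twisted by `w s_i`. -/
theorem marinG_mul_artinGen_mem_span (w : W) (i : B) :
    cs.marinG a w * cs.artinToMarin a (cs.artinGen i) ∈
      Submodule.span A (Set.range (cs.marinG a)) := by
  by_cases h : cs.IsRightDescent w i
  · have h' := cs.isRightDescent_iff_not_isRightDescent_mul.1 h
    have hw := cs.artinSection_mul_artinGen h'
    rw [simple_mul_simple_cancel_right] at hw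
    rw [marinG_eq, ← hw, map_mul, mul_assoc, artinToMarin_artinGen_mul_self, mul_add,
      ← coeffToMarin_mul, ← coeffToMarin_mul, ← mul_assoc, ← mul_assoc,
      artinToMarin_mul_coeffToMarin, artinToMarin_mul_coeffToMarin, mul_one, marin_smul_mul,
      ← map_mul, hw]
    exact Submodule.add_mem _ (Submodule.smul_mem _ _ (Submodule.subset_span ⟨_, rfl⟩))
      (Submodule.smul_mem _ _ (Submodule.subset_span ⟨_, rfl⟩))
  · rw [marinG_eq, ← map_mul, artinSection_mul_artinGen _ h]
    exact Submodule.subset_span ⟨_, rfl⟩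

theorem mul_mem_span_marinG {y : cs.MarinRing a}
    (hy : ∀ w, cs.marinG a w * y ∈ Submodule.span A (Set.range (cs.marinG a)))
    {x : cs.MarinRing a} (hx : x ∈ Submodule.span A (Set.range (cs.marinG a))) :
    x * y ∈ Submodule.span A (Set.range (cs.marinG a)) := by
  induction hx using Submodule.span_induction with
  | mem x h => obtain ⟨w, rfl⟩ := h; exact hy w
  | zero => rw [zero_mul]; exact Submodule.zero_mem _
  | add x x' _ _ h h' => rw [add_mul]; exact Submodule.add_mem _ h h'
  | smul c x _ h => rw [marin_smul_mul]; exact Submodule.smul_mem _ _ h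

theorem mul_coeffToMarin_mem_span {x : cs.MarinRing a}
    (hx : x ∈ Submodule.span A (Set.range (cs.marinG a))) (c : A) :
    x * cs.coeffToMarin a c ∈ Submodule.span A (Set.range (cs.marinG a)) := by
  refine cs.mul_mem_span_marinG a (fun w => ?_) hx
  rw [marinG_eq, artinToMarin_mul_coeffToMarin]
  exact Submodule.smul_mem _ _ (Submodule.subset_span ⟨w, rfl⟩)

theorem mul_artinToMarin_mem_span (b : cs.ArtinGroup) {x : cs.MarinRing a}
    (hx : x ∈ Submodule.span A (Set.range (cs.marinG a))) :
    x * cs.artinToMarin a b ∈ Submodule.span A (Set.range (cs.marinG a)) := by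
  have hb : b ∈ Subgroup.closure (Set.range cs.artinGen) := by
    rw [closure_range_artinGen]; trivial
  induction hb using Subgroup.closure_induction'' generalizing x with
  | mem b h =>
    obtain ⟨i, rfl⟩ := h
    exact cs.mul_mem_span_marinG a (fun w => cs.marinG_mul_artinGen_mem_span a w i) hx
  | inv_mem b h =>
    obtain ⟨i, rfl⟩ := h
    rw [artinToMarin_artinGen_inv, ← mul_assoc, mul_sub]
    have := cs.mul_coeffToMarin_mem_span a hx ↑(a i)⁻¹
    exact Submodule.sub_mem _
      (cs.mul_mem_span_marinG a (fun w => cs.marinG_mul_artinGen_mem_span a w i) this)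
      (cs.mul_coeffToMarin_mem_span a this _)
  | one => simpa using hx
  | mul b b' _ _ h h' => rw [map_mul, ← mul_assoc]; exact h' (h hx)

theorem span_range_marinG : Submodule.span A (Set.range (cs.marinG a)) = ⊤ := by
  rw [eq_top_iff]
  rintro x -
  obtain ⟨y, rfl⟩ := Ideal.Quotient.mk_surjective x
  induction y using SkewMonoidAlgebra.induction_on with
  | zero => rw [map_zero]; exact Submodule.zero_mem _
  | single b c =>
    have h1 : (1 : cs.MarinRing a) ∈ Submodule.span A (Set.range (cs.marinG a)) :=
      Submodule.subset_span ⟨1, by rw [marinG_eq, artinSection_one, map_one]⟩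
    have h := Submodule.smul_mem _ c (cs.mul_artinToMarin_mem_span a b h1)
    rw [one_mul] at h
    convert h using 1
    rw [← SkewMonoidAlgebra.smul_of]
    rfl
  | add f g hf hg => rw [map_add]; exact Submodule.add_mem _ hf hg

/-- Comparing `(gᵢ²) c` with `c (gᵢ²)` in the Marin ring. -/
theorem smul_artinToMarin_artinGen_eq (i : B) (c : A) :
    ((1 - (a i : A)) * (cs.simple i • c)) • cs.artinToMarin a (cs.artinGen i) =
      ((1 - (a i : A)) * c) • cs.artinToMarin a (cs.artinGen i) := by
  -- The square commutes with `c` because `s_i ^ 2 = 1` acts trivially; only the linear term of its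
  -- expansion twists `c`.
  have h : cs.artinToMarin a (cs.artinGen i) * cs.artinToMarin a (cs.artinGen i) *
        cs.coeffToMarin a c =
      c • (cs.artinToMarin a (cs.artinGen i) * cs.artinToMarin a (cs.artinGen i)) := by
    rw [← map_mul, artinToMarin_mul_coeffToMarin, map_mul, artinProj_artinGen,
      simple_mul_simple_self, one_smul]
  rw [artinToMarin_artinGen_mul_self, add_mul, marin_smul_mul, marin_smul_mul,
    artinToMarin_mul_coeffToMarin, artinProj_artinGen, one_mul,
    ← mul_one (cs.coeffToMarin a c), coeffToMarin_mul, smul_add, smul_smul, smul_smul, smul_smul,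
    smul_smul, mul_comm c, mul_comm c] at h
  exact add_left_cancel h

end Spanning

/-! ### The representation of the Marin ring and linear independence. -/

section Representation

/-- A root `x` of a quadratic equation with invertible constant term, as a unit. -/
def unitOfQuadratic {R : Type*} [Ring R] {x p q r : R} (h : x * x = p + q * x)
    (hq : x * q = q * x) (hr : x * r = r * x) (hrp : r * p = 1) : Rˣ where
  val := x
  inv := r * (x - q)
  val_inv := by rw [← mul_assoc, hr, mul_assoc, mul_sub, h, hq, add_sub_cancel_right, hrp]
  inv_val := by rw [mul_assoc, sub_mul, h, add_sub_cancel_right, hrp]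

variable {cs} {a : B → Aˣ}

theorem IsEquivariant.simple_smul_inv (ha : cs.IsEquivariant a) (i : B) :
    cs.simple i • ((a i)⁻¹ : Aˣ).val = ((a i)⁻¹ : Aˣ).val := by
  apply Units.eq_inv_of_mul_eq_one_left
  conv_lhs => rw [← ha.simple_smul i]
  rw [← smul_mul', Units.mul_inv, smul_one]

variable (cs a) in
theorem leftOp_mul_toAddMonoidEnd (i : B) (c : A) :
    cs.leftOp a i * Module.toAddMonoidEnd A (W →₀ A) c =
      Module.toAddMonoidEnd A (W →₀ A) (cs.simple i • c) * cs.leftOp a i := by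
  ext1 v
  exact cs.leftOp_smul a i c v

theorem leftOp_mul_self (ha : cs.IsEquivariant a) (hd : cs.AnnihilatesDifferences a) (i : B) :
    cs.leftOp a i * cs.leftOp a i = Module.toAddMonoidEnd A (W →₀ A) (a i)
      + Module.toAddMonoidEnd A (W →₀ A) (1 - a i) * cs.leftOp a i := by
  ext1 v
  exact leftOp_leftOp ha hd i v

/-- Left multiplication by `gᵢ` as an invertible endomorphism. -/
noncomputable def leftOpUnit (ha : cs.IsEquivariant a) (hd : cs.AnnihilatesDifferences a) (i : B) :
    (AddMonoid.End (W →₀ A))ˣ :=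
  unitOfQuadratic (leftOp_mul_self ha hd i)
    (r := Module.toAddMonoidEnd A (W →₀ A) ↑(a i)⁻¹)
    (by rw [leftOp_mul_toAddMonoidEnd, smul_sub, smul_one, ha.simple_smul])
    (by rw [leftOp_mul_toAddMonoidEnd, ha.simple_smul_inv])
    (by rw [← map_mul, Units.inv_mul, map_one])

/-- The representation of the Artin group on the free module with basis `W`. -/
noncomputable def artinRep (ha : cs.IsEquivariant a) (hd : cs.AnnihilatesDifferences a) :
    cs.ArtinGroup →* (AddMonoid.End (W →₀ A))ˣ :=
  PresentedGroup.toGroup (f := leftOpUnit ha hd) (by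
    rintro _ ⟨⟨i, j⟩, rfl⟩
    have h : ∀ ω : List B, ((FreeGroup.lift (leftOpUnit ha hd) (ω.map FreeGroup.of).prod :
        (AddMonoid.End (W →₀ A))ˣ) : AddMonoid.End (W →₀ A)) = (ω.map (cs.leftOp a)).prod := by
      intro ω
      rw [map_list_prod, ← Units.coeHom_apply, map_list_prod, List.map_map, List.map_map]
      refine congrArg List.prod (List.map_congr_left fun k _ => ?_)
      exact congrArg Units.val FreeGroup.lift_apply_of
    rw [map_mul, map_inv, mul_inv_eq_one]
    apply Units.ext
    rw [h, h]
    exact prod_leftOp_braidWord ha hd i j)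

theorem artinRep_artinGen (ha : cs.IsEquivariant a) (hd : cs.AnnihilatesDifferences a) (i : B) :
    (artinRep ha hd (cs.artinGen i) : AddMonoid.End (W →₀ A)) = cs.leftOp a i :=
  congrArg Units.val (PresentedGroup.toGroup.of _)

theorem toAddMonoidEnd_mul_artinRep (ha : cs.IsEquivariant a) (hd : cs.AnnihilatesDifferences a)
    (b : cs.ArtinGroup) (c : A) :
    Module.toAddMonoidEnd A (W →₀ A) (b • c) * artinRep ha hd b =
      artinRep ha hd b * Module.toAddMonoidEnd A (W →₀ A) c := by
  have hb : b ∈ Subgroup.closure (Set.range cs.artinGen) := by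
    rw [closure_range_artinGen]; trivial
  induction hb using Subgroup.closure_induction generalizing c with
  | mem b h =>
    obtain ⟨i, rfl⟩ := h
    rw [artinRep_artinGen, leftOp_mul_toAddMonoidEnd, artinGroup_smul_def, artinProj_artinGen]
  | one => simp
  | mul b b' _ _ h h' => rw [map_mul, Units.val_mul, ← mul_assoc, mul_smul, h, mul_assoc, h',
      mul_assoc]
  | inv b _ h =>
    -- Evaluating the relation for `b` at `b⁻¹ • c` and conjugating gives the one for `b⁻¹`.
    have := h (b⁻¹ • c)
    rw [smul_inv_smul] at this
    rw [map_inv, Units.mul_inv_eq_iff_eq_mul, mul_assoc, Units.eq_inv_mul_iff_mul_eq]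
    exact this.symm

/-- The representation of the skew group ring on the free module with basis `W`. -/
noncomputable def crossedProductRep (ha : cs.IsEquivariant a) (hd : cs.AnnihilatesDifferences a) :
    cs.CrossedProduct A →+* AddMonoid.End (W →₀ A) :=
  SkewMonoidAlgebra.liftNCRingHom (Module.toAddMonoidEnd A (W →₀ A))
    ((Units.coeHom _).comp (artinRep ha hd))
    (fun {c b} => toAddMonoidEnd_mul_artinRep ha hd b c)

theorem crossedProductRep_single (ha : cs.IsEquivariant a) (hd : cs.AnnihilatesDifferences a)
    (b : cs.ArtinGroup) (c : A) :
    crossedProductRep ha hd (SkewMonoidAlgebra.single b c) =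
      Module.toAddMonoidEnd A (W →₀ A) c * artinRep ha hd b :=
  SkewMonoidAlgebra.liftNC_single _ _ _ _

theorem crossedProductRep_heckeRelator (ha : cs.IsEquivariant a)
    (hd : cs.AnnihilatesDifferences a) (i : B) :
    crossedProductRep ha hd (cs.heckeRelator a i) = 0 := by
  rw [heckeRelator, map_sub, map_sub, map_mul, map_pow, crossedProductRep_single,
    crossedProductRep_single, crossedProductRep_single, artinRep_artinGen]
  simp only [map_one, one_mul, Units.val_one, mul_one, pow_two]
  rw [leftOp_mul_self ha hd, sub_sub, sub_self]

/-- The representation of the Marin ring on the free module with basis `W`. -/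
noncomputable def marinRep (ha : cs.IsEquivariant a) (hd : cs.AnnihilatesDifferences a) :
    cs.MarinRing a →+* AddMonoid.End (W →₀ A) :=
  Ideal.Quotient.lift _ (crossedProductRep ha hd) (by
    have h : cs.heckeIdeal a ≤ TwoSidedIdeal.ker (crossedProductRep ha hd) := by
      rw [heckeIdeal, TwoSidedIdeal.span_le]
      rintro _ ⟨i, rfl⟩
      exact (TwoSidedIdeal.mem_ker _).2 (crossedProductRep_heckeRelator ha hd i)
    intro x hx
    exact (TwoSidedIdeal.mem_ker _).1 (h (TwoSidedIdeal.mem_asIdeal.1 hx)))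

/-- The `A`-linear map `x ↦ x · e₁` from the Marin ring to the free module with basis `W`. -/
noncomputable def marinOrbit (ha : cs.IsEquivariant a) (hd : cs.AnnihilatesDifferences a) :
    cs.MarinRing a →ₗ[A] (W →₀ A) where
  toFun x := marinRep ha hd x (Finsupp.single 1 1)
  map_add' x y := by rw [map_add]; rfl
  map_smul' c x := by
    rw [← coeffToMarin_mul, map_mul]
    have : marinRep ha hd (cs.coeffToMarin a c) = Module.toAddMonoidEnd A (W →₀ A) c := by
      refine (crossedProductRep_single ha hd 1 c).trans ?_
      simp
    rw [this]
    rfl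

theorem marinOrbit_marinG (ha : cs.IsEquivariant a) (hd : cs.AnnihilatesDifferences a) (w : W) :
    marinOrbit ha hd (cs.marinG a w) = Finsupp.single w 1 := by
  obtain ⟨ω, hω, rfl⟩ := cs.exists_isReduced w
  have h : marinRep ha hd (cs.marinG a (cs.wordProd ω)) = (ω.map (cs.leftOp a)).prod := by
    refine (crossedProductRep_single ha hd _ 1).trans ?_
    rw [map_one, one_mul, hω.artinSection_wordProd, map_list_prod, ← Units.coeHom_apply,
      map_list_prod, List.map_map, List.map_map]
    exact congrArg List.prod (List.map_congr_left fun k _ => artinRep_artinGen ha hd k)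
  rw [← hω.prod_leftOp_single_one a, ← h]
  rfl

theorem linearIndependent_marinG (ha : cs.IsEquivariant a) (hd : cs.AnnihilatesDifferences a) :
    LinearIndependent A (cs.marinG a) := by
  apply LinearIndependent.of_comp (marinOrbit ha hd)
  have : marinOrbit ha hd ∘ cs.marinG a = fun w => Finsupp.single w 1 :=
    funext (marinOrbit_marinG ha hd)
  rw [this]
  exact Finsupp.linearIndependent_single_one A W

end Representation

end CoxeterSystem

theorem mainTheorem1 {B W k A : Type*} [Group W] {M : CoxeterMatrix B} (cs : CoxeterSystem M W)
    [CommRing k] [CommRing A] [Algebra k A] [Module.Free k A]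
    [MulSemiringAction W A] [SMulCommClass W k A]
    (a : B → Aˣ) (ha : cs.IsEquivariant a) :
    (∃ b : Module.Basis W A (cs.MarinRing a), ∀ w : W, b w = cs.marinG a w) ↔
      ∀ i : B, (1 - LinearMap.mulLeft k (a i : A)) *
        (1 - DistribSMul.toLinearMap k A (cs.simple i)) = (0 : Module.End k A) := by
  have hiff : (∀ i : B, (1 - LinearMap.mulLeft k (a i : A)) *
      (1 - DistribSMul.toLinearMap k A (cs.simple i)) = (0 : Module.End k A)) ↔
      cs.AnnihilatesDifferences a := by
    refine forall_congr' fun i => ?_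
    rw [LinearMap.ext_iff]
    refine forall_congr' fun c => ?_
    have : ((1 - LinearMap.mulLeft k (a i : A)) *
        (1 - DistribSMul.toLinearMap k A (cs.simple i))) c =
        (1 - (a i : A)) * c - (1 - (a i : A)) * (cs.simple i • c) := by
      simp only [Module.End.mul_apply, LinearMap.sub_apply, Module.End.one_apply,
        LinearMap.mulLeft_apply, DistribSMul.toLinearMap_apply]
      ring
    rw [this, LinearMap.zero_apply, sub_eq_zero, eq_comm]
  rw [hiff]
  constructor
  · rintro ⟨b, hb⟩ i c
    have h := cs.smul_artinToMarin_artinGen_eq a i c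
    rw [← cs.artinSection_simple, ← cs.marinG_eq, ← hb] at h
    -- `g_i` is the basis vector indexed by `s_i`, so its own coordinate recovers the coefficients.
    simpa using congrArg (fun x => b.repr x (cs.simple i)) h
  · intro hd
    refine ⟨Module.Basis.mk (cs.linearIndependent_marinG ha hd) (cs.span_range_marinG a).ge, ?_⟩
    intro w
    rw [Module.Basis.mk_apply]
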